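/- Let $\mathbb{R}^4$ be Minkowski spacetime with inertial coordinates $x^0,x^1,x^2,x^3$, metric $\eta_{ab}=\mathrm{diag}(1,-1,-1,-1)$ (used to raise and lower indices), and totally antisymmetric tensor $\epsilon^{abcd}$ with $\epsilon^{0123}=1$. For a smooth symmetric tensor field $h_{ab}$ on an open set, let $h=h_a{}^a$ and let $$R_{abcd}=\tfrac12(\partial_b\partial_c h_{ad}+\partial_a\partial_d h_{bc}-\partial_a\partial_c h_{bd}-\partial_b\partial_d h_{ac}),\quad R_{ab}=\eta^{cd}R_{acbd},\quad R=\eta^{ab}R_{ab},\quad G_{ab}=R_{ab}-\tfrac12\eta_{ab}R$$ be the linearized Riemann, Ricci and Einstein tensors. $h_{ab}$ is called a source-free solution if $G_{ab}=0$, and it is said to be in traceless harmonic gauge if $\partial_a h^{ab}=0$ and $h=0$. Its Fierz tensor is $$F_{abc}=\tfrac12\bigl(\partial_a h_{bc}-\partial_b h_{ac}+\partial_d h^d{}_a\,\eta_{bc}-\partial_d h^d{}_b\,\eta_{ac}-\partial_a h\,\eta_{bc}+\partial_b h\,\eta_{ac}\bigr),$$ and $\tilde F^{ab}{}_c=\tfrac12\epsilon^{abde}F_{dec}$.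 A source-free solution $h'_{ab}$ is called a dual of the source-free solution $h_{ab}$ on an open set $U$ if, on $U$, the Fierz tensor of $h'_{ab}$ is equal to $\tilde F_{abc}$. Proposition (duality in traceless harmonic gauge). Let $\Omega\subseteq\mathbb{R}^4$ be open with $H^2_{\mathrm{dR}}(\Omega)=0$, let $h_{ab}$ be a smooth symmetric source-free solution on $\Omega$ in traceless harmonic gauge, and let $U$ be a bounded open set with $\overline U\subset\Omega$. Then $h_{ab}$ has a dual, defined (and smooth and symmetric) on $U$, that satisfies the traceless harmonic gauge conditions on $U$. -/

import Mathlib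

open scoped ContDiff

namespace LinGrav

noncomputable section

/-! Minkowski spacetime is `ℝ⁴` with inertial coordinates `x⁰, x¹, x², x³`.  Tensor fields are
given by their components in these coordinates.  Fields on an open set `Ω` are represented by
functions on the whole of `ℝ⁴` of which only the values on `Ω` matter. -/

/-- Minkowski spacetime in inertial coordinates. -/
abbrev Spacetime : Type := Fin 4 → ℝ

/-- A covariant rank two tensor field, `h x a b` being the component `h_{ab}` at `x`. -/
abbrev Tensor2 : Type := Spacetime → Fin 4 → Fin 4 → ℝ

/-- A covariant rank three tensor field, `T x a b c` being the component `T_{abc}` at `x`. -/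
abbrev Tensor3 : Type := Spacetime → Fin 4 → Fin 4 → Fin 4 → ℝ

/-- The Minkowski metric of signature `(+,-,-,-)`.  The components `η^{ab}` of the inverse metric
are numerically equal to the components `η_{ab}`. -/
def eta (a b : Fin 4) : ℝ := if a = b then (if a = 0 then 1 else -1) else 0

/-- The totally antisymmetric tensor `ε^{abcd}` with upper indices and `ε^{0123} = 1`: the
determinant of the matrix whose rows are the basis vectors with numbers `a, b, c, d`. -/
def epsilon (a b c d : Fin 4) : ℝ :=
  Matrix.det (Matrix.of fun i j : Fin 4 => if ![a, b, c, d] i = j then (1 : ℝ) else 0)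

/-- The partial derivative `∂_a f`. -/
def pd (a : Fin 4) (f : Spacetime → ℝ) (x : Spacetime) : ℝ := fderiv ℝ f x (Pi.single a 1)

/-- The trace `h = η^{ab} h_{ab}`. -/
def trace (h : Tensor2) (x : Spacetime) : ℝ := ∑ a, ∑ b, eta a b * h x a b

/-- The divergence `∂_d h^d_a = η^{de} ∂_d h_{ea}`. -/
def divergence (h : Tensor2) (x : Spacetime) (a : Fin 4) : ℝ :=
  ∑ d, ∑ e, eta d e * pd d (fun y => h y e a) x

/-- The linearized Riemann tensor
`R_{abcd} = ½ (∂_{bc} h_{ad} + ∂_{ad} h_{bc} - ∂_{ac} h_{bd} - ∂_{bd} h_{ac})`. -/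
def riemann (h : Tensor2) (x : Spacetime) (a b c d : Fin 4) : ℝ :=
  (1 / 2) * (pd b (pd c fun y => h y a d) x + pd a (pd d fun y => h y b c) x
    - pd a (pd c fun y => h y b d) x - pd b (pd d fun y => h y a c) x)

/-- The linearized Ricci tensor `R_{ab} = η^{cd} R_{acbd}`. -/
def ricci (h : Tensor2) : Tensor2 := fun x a b => ∑ c, ∑ d, eta c d * riemann h x a c b d

/-- The linearized Einstein tensor `G_{ab} = R_{ab} - ½ η_{ab} R`, where `R = η^{cd} R_{cd}`. -/
def einstein (h : Tensor2) : Tensor2 := fun x a b =>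
  ricci h x a b - (1 / 2) * eta a b * trace (ricci h) x

/-- The Fierz tensor `F_{abc} = ½ (∂_a h_{bc} - ∂_b h_{ac} + ∂_d h^d_a η_{bc} - ∂_d h^d_b η_{ac}
- ∂_a h η_{bc} + ∂_b h η_{ac})`. -/
def fierz (h : Tensor2) : Tensor3 := fun x a b c =>
  (1 / 2) * (pd a (fun y => h y b c) x - pd b (fun y => h y a c) x
    + divergence h x a * eta b c - divergence h x b * eta a c
    - pd a (trace h) x * eta b c + pd b (trace h) x * eta a c)

/-- The Hodge dual in the first two indices, `T̃^{ab}_c = ½ ε^{abde} T_{dec}`, with all the indices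
lowered: `T̃_{abc} = ½ η_{am} η_{bn} ε^{mnde} T_{dec}`. -/
def hodge (T : Tensor3) : Tensor3 := fun x a b c =>
  (1 / 2) * ∑ m, ∑ n, ∑ d, ∑ e, eta a m * eta b n * epsilon m n d e * T x d e c

/-- `h_{ab}` is a (smooth, symmetric) solution on `Ω` of the linearized Einstein equations without
source. -/
structure IsVacuumSolution (h : Tensor2) (Ω : TopologicalSpace.Opens Spacetime) : Prop where
  smooth : ∀ a b, ContDiffOn ℝ ∞ (fun x => h x a b) Ω
  symm : ∀ x ∈ Ω, ∀ a b, h x a b = h x b a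
  einstein_eq : ∀ x ∈ Ω, ∀ a b, einstein h x a b = 0

/-- The traceless harmonic gauge conditions `∂_a h^{ab} = 0` and `h = 0` on `Ω`. -/
structure IsTracelessHarmonic (h : Tensor2) (Ω : TopologicalSpace.Opens Spacetime) : Prop where
  divergence_eq : ∀ x ∈ Ω, ∀ a, divergence h x a = 0
  trace_eq : ∀ x ∈ Ω, trace h x = 0

/-- `h'` is a dual of `h` on `Ω`: both are solutions of the linearized Einstein equations without
source on `Ω`, and the Fierz tensor of `h'` is the Hodge dual of the Fierz tensor of `h`. -/
structure IsDual (h' h : Tensor2) (Ω : TopologicalSpace.Opens Spacetime) : Prop where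
  solution : IsVacuumSolution h Ω
  solution' : IsVacuumSolution h' Ω
  fierz_eq : ∀ x ∈ Ω, ∀ a b c, fierz h' x a b c = hodge (fierz h) x a b c

/-! ### De Rham cohomology of an open set -/

/-- Differential forms of degree `k`. -/
abbrev Form (k : ℕ) : Type := Spacetime → Spacetime [⋀^Fin k]→L[ℝ] ℝ

/-- The differential forms of degree `k` that are smooth on `Ω`. -/
def smoothForms (k : ℕ) (Ω : TopologicalSpace.Opens Spacetime) : Submodule ℝ (Form k) where
  carrier := {α | ContDiffOn ℝ ∞ α Ω}
  add_mem' h₁ h₂ := ContDiffOn.add h₁ h₂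
  zero_mem' := contDiffOn_const
  smul_mem' c _ h := ContDiffOn.const_smul c h

theorem differentiableAt_of_mem_smoothForms {k : ℕ} {Ω : TopologicalSpace.Opens Spacetime}
    {α : Form k} (h : α ∈ smoothForms k Ω) {x : Spacetime} (hx : x ∈ Ω) :
    DifferentiableAt ℝ α x :=
  (ContDiffOn.contDiffAt h (Ω.isOpen.mem_nhds hx)).differentiableAt (by simp)

/-- The differential forms of degree `k` that are smooth and closed on `Ω`. -/
def closedForms (k : ℕ) (Ω : TopologicalSpace.Opens Spacetime) : Submodule ℝ (Form k) where
  carrier := {α | α ∈ smoothForms k Ω ∧ ∀ x ∈ Ω, extDeriv α x = 0}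
  add_mem' := fun {α₁ α₂} h₁ h₂ => ⟨add_mem h₁.1 h₂.1, fun x hx => by
    rw [extDeriv_add (differentiableAt_of_mem_smoothForms h₁.1 hx)
      (differentiableAt_of_mem_smoothForms h₂.1 hx), h₁.2 x hx, h₂.2 x hx, add_zero]⟩
  zero_mem' := ⟨zero_mem _, fun x _ => by
    simpa using extDeriv_smul (0 : ℝ) (0 : Form k) (x := x)⟩
  smul_mem' := fun c α h => ⟨Submodule.smul_mem _ c h.1, fun x hx => by
    rw [extDeriv_smul, h.2 x hx, smul_zero]⟩

/-- The differential forms of degree `k` that are exact on `Ω`, i.e. equal on `Ω` to `dη` for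
some `η` smooth on `Ω`; in degree zero, the functions that vanish on `Ω`. -/
def exactForms : (k : ℕ) → (Ω : TopologicalSpace.Opens Spacetime) → Submodule ℝ (Form k)
  | 0, Ω =>
    { carrier := {α | ∀ x ∈ Ω, α x = 0}
      add_mem' := fun h₁ h₂ x hx => by simp [h₁ x hx, h₂ x hx]
      zero_mem' := fun _ _ => rfl
      smul_mem' := fun c α h x hx => by simp [h x hx] }
  | k + 1, Ω =>
    { carrier := {α | ∃ η ∈ smoothForms k Ω, ∀ x ∈ Ω, α x = extDeriv η x}
      add_mem' := by
        rintro α₁ α₂ ⟨η₁, h₁, e₁⟩ ⟨η₂, h₂, e₂⟩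
        refine ⟨η₁ + η₂, add_mem h₁ h₂, fun x hx => ?_⟩
        rw [extDeriv_add (differentiableAt_of_mem_smoothForms h₁ hx)
          (differentiableAt_of_mem_smoothForms h₂ hx), ← e₁ x hx, ← e₂ x hx, Pi.add_apply]
      zero_mem' := ⟨0, zero_mem _, fun x _ => by
        simpa using (extDeriv_smul (0 : ℝ) (0 : Form k) (x := x)).symm⟩
      smul_mem' := by
        rintro c α ⟨η, h, e⟩
        refine ⟨c • η, Submodule.smul_mem _ c h, fun x hx => ?_⟩
        rw [extDeriv_smul, ← e x hx, Pi.smul_apply] }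

set_option maxSynthPendingDepth 6 in
/-- The de Rham cohomology space `H^k_dR(Ω)`: closed forms modulo exact forms.  Two functions that
agree on `Ω` differ by a form that is exact on `Ω`, so values off `Ω` do not matter. -/
abbrev DeRhamCohomology (k : ℕ) (Ω : TopologicalSpace.Opens Spacetime) : Type :=
  closedForms k Ω ⧸ (exactForms k Ω).submoduleOf (closedForms k Ω)

set_option maxSynthPendingDepth 6 in
/-- `H^{k+1}_dR(Ω) = 0` says that every smooth closed form of degree `k + 1` on `Ω` is exact. -/
theorem subsingleton_deRhamCohomology_succ_iff (k : ℕ) (Ω : TopologicalSpace.Opens Spacetime) :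
    Subsingleton (DeRhamCohomology (k + 1) Ω) ↔
      ∀ α : Form (k + 1), ContDiffOn ℝ ∞ α Ω → (∀ x ∈ Ω, extDeriv α x = 0) →
        ∃ η : Form k, ContDiffOn ℝ ∞ η Ω ∧ ∀ x ∈ Ω, α x = extDeriv η x := by
  rw [Submodule.Quotient.subsingleton_iff, Submodule.submoduleOf_eq_top]
  exact ⟨fun h α h₁ h₂ => h ⟨h₁, h₂⟩, fun h α h₁ => h α h₁.1 h₁.2⟩

end

end LinGrav

/-! In the traceless harmonic gauge the Fierz tensor is half a curl: for each fixed last index `c`,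
`F_{abc}` is a two-form in `a, b`. Hodge duality exchanges closed with coclosed, and likewise the
cyclic identity with vanishing trace (`star_cyclic`, `star_div`). The gauge conditions and the wave
equation make `F` divergence-free and trace-free, so its dual `F̃` is closed and cyclic; equality of
mixed partials and the symmetry of `h` make `F̃` divergence-free and trace-free.

Since `H² = 0`, closedness yields `k_{bc}` with curl `2F̃`. The cyclic identity makes the
antisymmetric part of `k` closed, hence exact, and subtracting some `∂_b ξ_c` makes `k` symmetric
(`exists_symmetric_potential`). Adding the Hessian of `χ` keeps symmetry and curl and shifts the
trace by `□χ`, so the trace is removed by a wave equation. Its source is cut off to compact support,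
which is why the dual lives only on the relatively compact `U`. The vanishing trace of `F̃` then
forces the harmonic gauge, and its vanishing divergence forces the wave equation, i.e. the Einstein
equations (`tracelessHarmonic_of_curl`).

The wave equation itself is solved in `exists_wave_solution`: conjugation by `exp (2π x⁰)` moves the
symbol off its real zeros, after which one divides on the Fourier side. -/

open scoped ContDiff

namespace LinGrav

noncomputable section

/-! ### The wave equation -/

open scoped SchwartzMap FourierTransform LineDeriv
open Real

/-- The modulus squared of `(1 + i k₀)² + |𝐤|²`. -/
theorem one_add_norm_sq_eq_modulus_sq (k : EuclideanSpace ℝ (Fin 4)) :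
    1 + ‖(WithLp.toLp 2 (k, WithLp.toLp 2
      (k, k 0 ^ 2 - k 1 ^ 2 - k 2 ^ 2 - k 3 ^ 2)) :
        WithLp 2 (EuclideanSpace ℝ (Fin 4) × WithLp 2 (EuclideanSpace ℝ (Fin 4) × ℝ)))‖ ^ 2 =
      (1 - k 0 ^ 2 + k 1 ^ 2 + k 2 ^ 2 + k 3 ^ 2) ^ 2 + (2 * k 0) ^ 2 := by
  simp only [WithLp.prod_norm_sq_eq_of_L2, WithLp.toLp_fst, WithLp.toLp_snd, EuclideanSpace.norm_sq_eq, Fin.sum_univ_four,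
    Real.norm_eq_abs, sq_abs]
  ring

/-- The symbol of `(1 + ∂₀)² - ∂₁² - ∂₂² - ∂₃²`, up to scaling. -/
def shiftedWaveSymbol (k : EuclideanSpace ℝ (Fin 4)) : ℂ :=
  ((1 - k 0 ^ 2 + k 1 ^ 2 + k 2 ^ 2 + k 3 ^ 2 : ℝ) : ℂ) + ((2 * k 0 : ℝ) : ℂ) * Complex.I

theorem normSq_shiftedWaveSymbol (k : EuclideanSpace ℝ (Fin 4)) :
    Complex.normSq (shiftedWaveSymbol k) =
      (1 - k 0 ^ 2 + k 1 ^ 2 + k 2 ^ 2 + k 3 ^ 2) ^ 2 + (2 * k 0) ^ 2 := by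
  rw [shiftedWaveSymbol, Complex.normSq_add_mul_I]

theorem shiftedWaveSymbol_ne_zero (k : EuclideanSpace ℝ (Fin 4)) : shiftedWaveSymbol k ≠ 0 := by
  rw [← Complex.normSq_pos, normSq_shiftedWaveSymbol, ← one_add_norm_sq_eq_modulus_sq]
  positivity

theorem hasTemperateGrowth_coord (i : Fin 4) :
    Function.HasTemperateGrowth (fun k : EuclideanSpace ℝ (Fin 4) => k i) :=
  (EuclideanSpace.proj (𝕜 := ℝ) i : EuclideanSpace ℝ (Fin 4) →L[ℝ] ℝ).hasTemperateGrowth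

/-- With `q = k₀² - k₁² - k₂² - k₃²`, the squared modulus of the symbol `s` is `1 + 2|k|² + q²`,
that is `1 + ‖(k, (k, q))‖²`. Hence `1/s` is the conjugate of `s` times `(1 + ‖·‖²)⁻¹` composed with
a polynomial map. -/
theorem hasTemperateGrowth_inv_shiftedWaveSymbol :
    Function.HasTemperateGrowth (fun k => (shiftedWaveSymbol k)⁻¹) := by
  have h0 := hasTemperateGrowth_coord 0
  have h1 := hasTemperateGrowth_coord 1
  have h2 := hasTemperateGrowth_coord 2
  have h3 := hasTemperateGrowth_coord 3
  have hI := Function.Complex.hasTemperateGrowth_ofReal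
  have hconj : Function.HasTemperateGrowth (fun k : EuclideanSpace ℝ (Fin 4) =>
      ((1 - k 0 ^ 2 + k 1 ^ 2 + k 2 ^ 2 + k 3 ^ 2 : ℝ) : ℂ) - ((2 * k 0 : ℝ) : ℂ) * Complex.I) := by
    fun_prop
  have hq : Function.HasTemperateGrowth (fun k : EuclideanSpace ℝ (Fin 4) =>
      k 0 ^ 2 - k 1 ^ 2 - k 2 ^ 2 - k 3 ^ 2) := by fun_prop
  -- `A k = (k, (k, 0))` and `B t = (0, (0, t))`, so `A k + B (q k)` is the vector `(k, (k, q k))`.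
  let A : EuclideanSpace ℝ (Fin 4) →L[ℝ]
      WithLp 2 (EuclideanSpace ℝ (Fin 4) × WithLp 2 (EuclideanSpace ℝ (Fin 4) × ℝ)) :=
    (WithLp.prodContinuousLinearEquiv 2 ℝ _ _).symm.toContinuousLinearMap ∘L
      (ContinuousLinearMap.id ℝ _).prod
        ((WithLp.prodContinuousLinearEquiv 2 ℝ _ _).symm.toContinuousLinearMap ∘L
          ContinuousLinearMap.inl ℝ _ _)
  let B : ℝ →L[ℝ]
      WithLp 2 (EuclideanSpace ℝ (Fin 4) × WithLp 2 (EuclideanSpace ℝ (Fin 4) × ℝ)) :=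
    (WithLp.prodContinuousLinearEquiv 2 ℝ _ _).symm.toContinuousLinearMap ∘L
      ContinuousLinearMap.inr ℝ _ _ ∘L
        ((WithLp.prodContinuousLinearEquiv 2 ℝ _ _).symm.toContinuousLinearMap ∘L
          ContinuousLinearMap.inr ℝ _ _)
  have hF := A.hasTemperateGrowth.add (B.hasTemperateGrowth.comp hq)
  have hinv := (Function.hasTemperateGrowth_one_add_norm_sq_rpow
    (WithLp 2 (EuclideanSpace ℝ (Fin 4) × WithLp 2 (EuclideanSpace ℝ (Fin 4) × ℝ))) (-1)).comp hF
  suffices hfun : (fun k => (shiftedWaveSymbol k)⁻¹) = _ from hfun ▸ (hI.comp hinv).mul hconj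
  ext1 k
  have hAB : (⇑A + (⇑B ∘ fun k : EuclideanSpace ℝ (Fin 4) =>
      k 0 ^ 2 - k 1 ^ 2 - k 2 ^ 2 - k 3 ^ 2)) k = WithLp.toLp 2 (k, WithLp.toLp 2
      (k, k 0 ^ 2 - k 1 ^ 2 - k 2 ^ 2 - k 3 ^ 2)) := by
    apply (WithLp.prodContinuousLinearEquiv 2 ℝ _ _).injective
    refine Prod.ext (by simp [A, B]) ?_
    apply (WithLp.prodContinuousLinearEquiv 2 ℝ _ _).injective
    exact Prod.ext (by simp [A, B]) (by simp [A, B])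
  simp only [Pi.mul_apply, Function.comp_apply]
  rw [hAB, one_add_norm_sq_eq_modulus_sq, Real.rpow_neg_one, ← normSq_shiftedWaveSymbol, Complex.inv_def,
    mul_comm]
  congr 1
  simp only [shiftedWaveSymbol, map_add, map_mul, Complex.conj_ofReal, Complex.conj_I]
  ring

/-- The partial derivative of a Schwartz function along a coordinate axis. -/
def coordDeriv (i : Fin 4) (u : 𝓢(EuclideanSpace ℝ (Fin 4), ℂ)) :
    𝓢(EuclideanSpace ℝ (Fin 4), ℂ) :=
  ∂_{EuclideanSpace.single i (1 : ℝ)} u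

/-- The equation `(∂₀ + 2π)² u - ∂₁² u - ∂₂² u - ∂₃² u = g` has a solution in the Schwartz space. -/
theorem exists_schwartzMap_shiftedWave (g : 𝓢(EuclideanSpace ℝ (Fin 4), ℂ)) :
    ∃ u : 𝓢(EuclideanSpace ℝ (Fin 4), ℂ), ∀ x,
      coordDeriv 0 (coordDeriv 0 u) x
        + 4 * π * coordDeriv 0 u x + 4 * π ^ 2 * u x
        - coordDeriv 1 (coordDeriv 1 u) x
        - coordDeriv 2 (coordDeriv 2 u) x
        - coordDeriv 3 (coordDeriv 3 u) x = g x := by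
  -- On the Fourier side `∂_j` is multiplication by `2πi k_j`, so the operator has symbol `4π² ((1 +
  -- i k₀)² + k₁² + k₂² + k₃²)`, which can be divided out.
  obtain ⟨u, hu⟩ : ∃ u : 𝓢(EuclideanSpace ℝ (Fin 4), ℂ),
      𝓕 u = (4 * π ^ 2 : ℂ)⁻¹ • SchwartzMap.smulLeftCLM ℂ (fun k => (shiftedWaveSymbol k)⁻¹) (𝓕 g) :=
    ⟨𝓕⁻ _, FourierTransform.fourier_fourierInv_eq _⟩
  refine ⟨u, fun x => ?_⟩
  have hD (i : Fin 4) (v : 𝓢(EuclideanSpace ℝ (Fin 4), ℂ)) (k : EuclideanSpace ℝ (Fin 4)) :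
      𝓕 (coordDeriv i v) k = 2 * π * Complex.I * ((k i : ℝ) * 𝓕 v k) := by
    rw [coordDeriv, SchwartzMap.fourier_lineDerivOp_eq, smul_apply,
      SchwartzMap.smulLeftCLM_apply_apply (by fun_prop)]
    simp [EuclideanSpace.inner_single_right]
  suffices H : coordDeriv 0 (coordDeriv 0 u)
        + (4 * π : ℂ) • coordDeriv 0 u + (4 * π ^ 2 : ℂ) • u
        - coordDeriv 1 (coordDeriv 1 u)
        - coordDeriv 2 (coordDeriv 2 u)
        - coordDeriv 3 (coordDeriv 3 u) = g by
    simpa using DFunLike.congr_fun H x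
  rw [← FourierTransform.fourierInv_fourier_eq (F := 𝓢(EuclideanSpace ℝ (Fin 4), ℂ)) g,
    ← FourierTransform.fourierInv_fourier_eq (F := 𝓢(EuclideanSpace ℝ (Fin 4), ℂ)) (_ - _)]
  congr 1
  ext k
  have huk : 𝓕 u k = (4 * π ^ 2 : ℂ)⁻¹ * ((shiftedWaveSymbol k)⁻¹ * 𝓕 g k) := by
    rw [hu, smul_apply,
      SchwartzMap.smulLeftCLM_apply_apply hasTemperateGrowth_inv_shiftedWaveSymbol]
    simp
  have hg : 𝓕 g k = 4 * π ^ 2 * shiftedWaveSymbol k * 𝓕 u k := by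
    have h1 := shiftedWaveSymbol_ne_zero k
    have h2 : (π : ℂ) ≠ 0 := by exact_mod_cast Real.pi_ne_zero
    rw [huk]
    field_simp
  simp only [sub_eq_add_neg, FourierTransform.fourier_add, FourierTransform.fourier_neg,
    FourierTransform.fourier_smul, add_apply, neg_apply,
    smul_apply, hD, hg, shiftedWaveSymbol]
  push_cast
  simp only [smul_eq_mul]
  linear_combination (4 * π ^ 2 * 𝓕 u k * (k 0 ^ 2 - k 1 ^ 2 - k 2 ^ 2 - k 3 ^ 2)) * Complex.I_sq

/-! ### Transfer from Schwartz functions to smooth functions on spacetime -/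

theorem pd_eq_of_hasFDerivAt {f : Spacetime → ℝ} {f' : Spacetime →L[ℝ] ℝ} {x : Spacetime}
    (hf : HasFDerivAt f f' x) (a : Fin 4) : pd a f x = f' (Pi.single a 1) := by
  rw [pd, hf.fderiv]

/-- The real part of a Schwartz function, as a function on spacetime. -/
def realPart (u : 𝓢(EuclideanSpace ℝ (Fin 4), ℂ)) (x : Spacetime) : ℝ := (u (WithLp.toLp 2 x)).re

theorem contDiff_realPart (u : 𝓢(EuclideanSpace ℝ (Fin 4), ℂ)) : ContDiff ℝ ∞ (realPart u) :=
  Complex.reCLM.contDiff.comp ((u.smooth ⊤).comp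
    (EuclideanSpace.equiv (Fin 4) ℝ).symm.toContinuousLinearMap.contDiff)

theorem pd_realPart (a : Fin 4) (u : 𝓢(EuclideanSpace ℝ (Fin 4), ℂ)) :
    pd a (realPart u) = realPart (coordDeriv a u) := by
  ext x
  have h := Complex.reCLM.hasFDerivAt.comp x ((u.differentiableAt.hasFDerivAt).comp x
    (EuclideanSpace.equiv (Fin 4) ℝ).symm.toContinuousLinearMap.hasFDerivAt)
  exact pd_eq_of_hasFDerivAt h a

/-- Conjugation by the exponential replaces `∂₀` by `∂₀ + 2π` and leaves the other derivatives
alone. -/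
theorem pd_exp_mul (a : Fin 4) {v : Spacetime → ℝ} (hv : ContDiff ℝ ∞ v) :
    pd a (fun x => Real.exp (2 * π * x 0) * v x) =
      fun x => Real.exp (2 * π * x 0) * ((if a = 0 then 2 * π * v x else 0) + pd a v x) := by
  ext x
  have h0 : HasFDerivAt (fun x : Spacetime => x 0)
      (ContinuousLinearMap.proj (R := ℝ) (φ := fun _ : Fin 4 => ℝ) 0) x :=
    (ContinuousLinearMap.proj (R := ℝ) (φ := fun _ : Fin 4 => ℝ) 0).hasFDerivAt
  rw [pd_eq_of_hasFDerivAt ((h0.const_mul (2 * π)).exp.fun_mul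
    (hv.differentiable (by simp) x).hasFDerivAt) a]
  have hs : (Pi.single a (1 : ℝ) : Spacetime) 0 = if a = 0 then 1 else 0 := by
    rw [Pi.single_apply]; simp [eq_comm]
  simp [pd, hs]
  split_ifs <;> ring

/-- The wave equation `□χ = f` has a smooth solution on the whole of spacetime, for every smooth
`f` with compact support. -/
theorem exists_wave_solution {f : Spacetime → ℝ} (hf : ContDiff ℝ ∞ f) (hc : HasCompactSupport f) :
    ∃ χ : Spacetime → ℝ, ContDiff ℝ ∞ χ ∧ ∀ x,
      pd 0 (pd 0 χ) x - pd 1 (pd 1 χ) x - pd 2 (pd 2 χ) x - pd 3 (pd 3 χ) x = f x := by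
  let e := (EuclideanSpace.equiv (Fin 4) ℝ)
  -- The weight is unbounded, but compact support of `f` still makes `g` a Schwartz function.
  let g : EuclideanSpace ℝ (Fin 4) → ℂ := fun x => ((Real.exp (-(2 * π * e x 0)) * f (e x) : ℝ) : ℂ)
  have hg : ContDiff ℝ ∞ g := by
    have he : ContDiff ℝ ∞ e := e.toContinuousLinearMap.contDiff
    have h0 : ContDiff ℝ ∞ (fun x => e x 0) := contDiff_pi.1 he 0
    exact Complex.ofRealCLM.contDiff.comp
      ((contDiff_const.mul h0).neg.exp.mul (hf.comp he))
  have hgc : HasCompactSupport g := by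
    have h1 : HasCompactSupport (fun x => f (e x)) :=
      hc.comp_homeomorph e.toHomeomorph
    exact (h1.mul_left (f := fun x => Real.exp (-(2 * π * e x 0)))).comp_left
      (g := Complex.ofReal) Complex.ofReal_zero
  obtain ⟨u, hu⟩ := exists_schwartzMap_shiftedWave (hgc.toSchwartzMap hg)
  have hexp : ContDiff ℝ ∞ (fun x : Spacetime => Real.exp (2 * π * x 0)) :=
    (contDiff_const.mul (contDiff_apply ℝ ℝ 0)).exp
  refine ⟨fun x => Real.exp (2 * π * x 0) * realPart u x, hexp.mul (contDiff_realPart u),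
    fun x => ?_⟩
  have hz (v : 𝓢(EuclideanSpace ℝ (Fin 4), ℂ)) :
      ContDiff ℝ ∞ (fun x => 2 * π * realPart v x + realPart (coordDeriv 0 v) x) :=
    (contDiff_const.mul (contDiff_realPart _)).add (contDiff_realPart _)
  have hpd0 : pd 0 (fun x => 2 * π * realPart u x + realPart (coordDeriv 0 u) x) x =
      2 * π * realPart (coordDeriv 0 u) x + realPart (coordDeriv 0 (coordDeriv 0 u)) x := by
    have h1 := ((contDiff_realPart u).differentiable (by simp) x).hasFDerivAt
    have h2 := ((contDiff_realPart (coordDeriv 0 u)).differentiable (by simp) x).hasFDerivAt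
    rw [pd_eq_of_hasFDerivAt ((h1.const_mul (2 * π)).fun_add h2) 0]
    rw [← pd_realPart 0 (coordDeriv 0 u), ← pd_realPart 0 u]
    simp [pd]
  -- The operator has real coefficients and the source is real, so real parts may be taken.
  have H := congrArg Complex.re (hu (WithLp.toLp 2 x))
  rw [pd_exp_mul 0 (contDiff_realPart u), pd_exp_mul 1 (contDiff_realPart u),
    pd_exp_mul 2 (contDiff_realPart u), pd_exp_mul 3 (contDiff_realPart u)]
  simp only [pd_realPart, if_true, Fin.reduceEq, if_false, zero_add]
  rw [pd_exp_mul 0 (hz u), pd_exp_mul 1 (contDiff_realPart _),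
    pd_exp_mul 2 (contDiff_realPart _), pd_exp_mul 3 (contDiff_realPart _)]
  simp only [if_true, Fin.reduceEq, if_false, zero_add, hpd0, pd_realPart]
  have hval : ((hgc.toSchwartzMap hg) (WithLp.toLp 2 x)).re =
      Real.exp (-(2 * π * x 0)) * f x := rfl
  have hre : ∀ r : ℝ, ∀ z : ℂ, ((r : ℂ) * z).re = r * z.re := fun r z => by simp
  have h4 : (4 * π : ℂ) = ((4 * π : ℝ) : ℂ) := by push_cast; ring
  have h5 : (4 * π ^ 2 : ℂ) = ((4 * π ^ 2 : ℝ) : ℂ) := by push_cast; ring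
  rw [hval, h4, h5] at H
  simp only [Complex.sub_re, Complex.add_re, hre] at H
  have hE : Real.exp (2 * π * x 0) * Real.exp (-(2 * π * x 0)) = 1 := by
    rw [← Real.exp_add]; simp
  simp only [realPart]
  linear_combination Real.exp (2 * π * x 0) * H + f x * hE

end

noncomputable section

/-! ### The Poincaré lemma in components -/

/-- The constant two-form `dx^a ∧ dx^b`. -/
def wedgeCoord (a b : Fin 4) : Spacetime [⋀^Fin 2]→L[ℝ] ℝ :=
  ContinuousMultilinearMap.alternatization
    ((ContinuousMultilinearMap.mkPiAlgebra ℝ (Fin 2) ℝ).compContinuousLinearMap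
      fun i => ContinuousLinearMap.proj (R := ℝ) (φ := fun _ : Fin 4 => ℝ) (![a, b] i))

theorem wedgeCoord_apply (a b : Fin 4) (v : Fin 2 → Spacetime) :
    wedgeCoord a b v = v 0 a * v 1 b - v 1 a * v 0 b := by
  have hperm : (Finset.univ : Finset (Equiv.Perm (Fin 2))) = {1, Equiv.swap 0 1} := by decide
  rw [wedgeCoord, ContinuousMultilinearMap.alternatization_apply_apply, hperm,
    Finset.sum_pair (by decide)]
  simp [sub_eq_add_neg]

theorem pd_const_mul (c : ℝ) {f : Spacetime → ℝ} {x : Spacetime} (hf : DifferentiableAt ℝ f x)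
    (a : Fin 4) : pd a (fun y => c * f y) x = c * pd a f x := by
  simp [pd, fderiv_const_mul hf]

/-- The two-form with components `A_{ab}`. -/
def formOfComponents (A : Tensor2) : Form 2 := fun x =>
  ∑ a, ∑ b, (1 / 2 * A x a b) • wedgeCoord a b

/-- The double sum over ordered pairs gives `½ (A_{ab} - A_{ba})`; antisymmetry absorbs the factor
`½`. -/
theorem formOfComponents_single {A : Tensor2} {x : Spacetime} (hA : ∀ a b, A x a b = -A x b a)
    (a b : Fin 4) :
    formOfComponents A x ![Pi.single a 1, Pi.single b 1] = A x a b := by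
  have h := hA a b
  simp only [formOfComponents, ContinuousAlternatingMap.sum_apply,
    ContinuousAlternatingMap.smul_apply, wedgeCoord_apply, Matrix.cons_val_zero,
    Matrix.cons_val_one, Pi.single_apply, smul_eq_mul, mul_sub, Finset.sum_sub_distrib]
  simp
  linarith

theorem contDiffOn_formOfComponents {A : Tensor2} {Ω : Set Spacetime}
    (hA : ∀ a b, ContDiffOn ℝ ∞ (fun x => A x a b) Ω) :
    ContDiffOn ℝ ∞ (formOfComponents A) Ω :=
  ContDiffOn.sum fun a _ => ContDiffOn.sum fun b _ =>
    (contDiffOn_const.mul (hA a b)).smul contDiffOn_const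

/-- The Poincaré lemma in degree two, in terms of components. -/
theorem exists_potential {Ω : TopologicalSpace.Opens Spacetime}
    (hΩ : Subsingleton (DeRhamCohomology 2 Ω)) {A : Tensor2}
    (hA : ∀ a b, ContDiffOn ℝ ∞ (fun x => A x a b) Ω)
    (hanti : ∀ x ∈ Ω, ∀ a b, A x a b = -A x b a)
    (hclosed : ∀ x ∈ Ω, ∀ a b c, pd a (fun y => A y b c) x + pd b (fun y => A y c a) x
      + pd c (fun y => A y a b) x = 0) :
    ∃ k : Spacetime → Fin 4 → ℝ, (∀ a, ContDiffOn ℝ ∞ (fun x => k x a) Ω) ∧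
      ∀ x ∈ Ω, ∀ a b, A x a b = pd a (fun y => k y b) x - pd b (fun y => k y a) x := by
  have hsm := contDiffOn_formOfComponents hA
  obtain ⟨η, hη, hd⟩ := (subsingleton_deRhamCohomology_succ_iff 1 Ω).1 hΩ (formOfComponents A) hsm
    (by
      intro x hx
      have hdf : DifferentiableAt ℝ (formOfComponents A) x :=
        differentiableAt_of_mem_smoothForms hsm hx
      have hap (v w : Spacetime) (a : Fin 4) :
          fderiv ℝ (fun y => formOfComponents A y ![v, w]) x (Pi.single a 1) =
            pd a (fun y => formOfComponents A y ![v, w]) x := rfl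
      have hev (a b c : Fin 4) :
          pd a (fun y => formOfComponents A y ![Pi.single b 1, Pi.single c 1]) x =
            pd a (fun y => A y b c) x := by
        have : (fun y => formOfComponents A y ![Pi.single b 1, Pi.single c 1]) =ᶠ[nhds x]
            fun y => A y b c := by
          filter_upwards [Ω.isOpen.mem_nhds hx] with y hy
          exact formOfComponents_single (hanti y hy) b c
        rw [pd, this.fderiv_eq, pd]
      have hneg (a b c : Fin 4) : pd a (fun y => A y b c) x = -pd a (fun y => A y c b) x := by
        have : (fun y => A y b c) =ᶠ[nhds x] fun y => -A y c b := by
          filter_upwards [Ω.isOpen.mem_nhds hx] with y hy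
          exact hanti y hy b c
        rw [pd, this.fderiv_eq, pd, fderiv_fun_neg]; rfl
      apply ContinuousAlternatingMap.toAlternatingMap_injective
      refine Module.Basis.ext_alternating (Pi.basisFun ℝ (Fin 4)) fun v _ => ?_
      have h0 : (0 : Fin 3).removeNth (fun i => (Pi.single (v i) 1 : Spacetime)) =
          ![Pi.single (v 1) 1, Pi.single (v 2) 1] := by
        ext i; fin_cases i <;> rfl
      have h1 : (1 : Fin 3).removeNth (fun i => (Pi.single (v i) 1 : Spacetime)) =
          ![Pi.single (v 0) 1, Pi.single (v 2) 1] := by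
        ext i; fin_cases i <;> rfl
      have h2 : (2 : Fin 3).removeNth (fun i => (Pi.single (v i) 1 : Spacetime)) =
          ![Pi.single (v 0) 1, Pi.single (v 1) 1] := by
        ext i; fin_cases i <;> rfl
      simp only [Pi.basisFun_apply, ContinuousAlternatingMap.coe_toAlternatingMap]
      -- The alternating sum for `d` becomes the cyclic sum once the indices of the middle term are
      -- swapped.
      rw [extDeriv_apply hdf, Fin.sum_univ_three, h0, h1, h2, hap, hap, hap, hev, hev, hev,
        hneg (v 1)]
      have := hclosed x hx (v 0) (v 1) (v 2)
      simp
      linarith)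
  refine ⟨fun x b => η x ![Pi.single b 1], fun b => ?_, fun x hx a b => ?_⟩
  · exact (ContinuousAlternatingMap.apply ℝ Spacetime ℝ ![Pi.single b 1]).contDiff.comp_contDiffOn hη
  · have hdf : DifferentiableAt ℝ η x := differentiableAt_of_mem_smoothForms hη hx
    have h0 : (0 : Fin 2).removeNth ![(Pi.single a 1 : Spacetime), Pi.single b 1] =
          ![Pi.single b 1] := by
        ext i; fin_cases i; rfl
    have h1 : (1 : Fin 2).removeNth ![(Pi.single a 1 : Spacetime), Pi.single b 1] =
          ![Pi.single a 1] := by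
        ext i; fin_cases i; rfl
    rw [← formOfComponents_single (hanti x hx) a b, hd x hx, extDeriv_apply hdf, Fin.sum_univ_two,
      h0, h1]
    simp [pd, sub_eq_add_neg]

end

noncomputable section

/-! ### Algebra of the Hodge dual -/

/-- The matrix of basis rows times the Vandermonde matrix of `0, 1, 2, 3`, whose determinant is 12,
is the Vandermonde matrix of `a, b, c, d`. -/
theorem epsilon_eq (a b c d : Fin 4) :
    epsilon a b c d = (((b : ℕ) : ℝ) - ((a : ℕ) : ℝ)) * (((c : ℕ) : ℝ) - ((a : ℕ) : ℝ)) *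
      (((d : ℕ) : ℝ) - ((a : ℕ) : ℝ)) * (((c : ℕ) : ℝ) - ((b : ℕ) : ℝ)) *
      (((d : ℕ) : ℝ) - ((b : ℕ) : ℝ)) * (((d : ℕ) : ℝ) - ((c : ℕ) : ℝ)) / 12 := by
  have hioi : (Finset.Ioi (0 : Fin 4) = {1, 2, 3}) ∧ (Finset.Ioi (1 : Fin 4) = {2, 3}) ∧
      (Finset.Ioi (2 : Fin 4) = {3}) ∧ (Finset.Ioi (3 : Fin 4) = ∅) := by decide
  have hprod (v : Fin 4 → ℝ) : (Matrix.vandermonde v).det =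
      (v 1 - v 0) * (v 2 - v 0) * (v 3 - v 0) * (v 2 - v 1) * (v 3 - v 1) * (v 3 - v 2) := by
    rw [Matrix.det_vandermonde, Fin.prod_univ_four, hioi.1, hioi.2.1, hioi.2.2.1, hioi.2.2.2,
      Finset.prod_empty, Finset.prod_singleton, Finset.prod_pair (by decide),
      Finset.prod_insert (by decide), Finset.prod_pair (by decide)]
    ring
  have h : (Matrix.of fun i j : Fin 4 => if ![a, b, c, d] i = j then (1 : ℝ) else 0) *
      Matrix.vandermonde (fun i : Fin 4 => ((i : ℕ) : ℝ)) =
      Matrix.vandermonde (fun i : Fin 4 => ((![a, b, c, d] i : ℕ) : ℝ)) := by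
    ext i j
    simp [Matrix.mul_apply, Matrix.vandermonde_apply]
  have h' := congrArg Matrix.det h
  rw [Matrix.det_mul, hprod, hprod] at h'
  simp only [Matrix.cons_val_zero, Matrix.cons_val_one, Matrix.cons_val] at h'
  rw [epsilon, eq_div_iff (by norm_num), ← h']
  congr 1
  norm_num

/-- The Hodge dual of an antisymmetric tensor with two indices, all indices lowered. -/
def star (M : Fin 4 → Fin 4 → ℝ) (a b : Fin 4) : ℝ :=
  ∑ d, ∑ e, (1 / 2 * eta a a * eta b b * epsilon a b d e) * M d e

theorem hodge_eq_star (T : Tensor3) (x : Spacetime) (a b c : Fin 4) :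
    hodge T x a b c = star (fun d e => T x d e c) a b := by
  have h0 : ∀ a m : Fin 4, eta a m = if a = m then eta a a else 0 := by
    intro a m; simp only [eta]; split_ifs <;> simp_all
  have h : hodge T x a b c = (1 / 2) * ∑ m, ∑ n, (if a = m then (if b = n then
      ∑ d, ∑ e, eta a a * eta b b * epsilon m n d e * T x d e c else 0) else 0) := by
    rw [hodge]
    congr 1
    refine Finset.sum_congr rfl fun m _ => Finset.sum_congr rfl fun n _ => ?_
    rw [h0 a m, h0 b n]
    split_ifs <;> simp
  rw [h]
  simp only [Finset.sum_ite_irrel, Finset.sum_ite_eq, Finset.mem_univ, if_true,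
    Finset.sum_const_zero, star, Finset.mul_sum]
  exact Finset.sum_congr rfl fun d _ => Finset.sum_congr rfl fun e _ => by ring

theorem star_eq {M : Fin 4 → Fin 4 → ℝ} (hM : ∀ d e, M d e = -M e d) : star M =
    ![![0, -M 2 3, -M 3 1, -M 1 2], ![M 2 3, 0, M 0 3, -M 0 2],
      ![M 3 1, -M 0 3, 0, M 0 1], ![M 1 2, M 0 2, -M 0 1, 0]] := by
  have h01 := hM 0 1
  have h02 := hM 0 2
  have h03 := hM 0 3
  have h12 := hM 1 2
  have h13 := hM 1 3
  have h23 := hM 2 3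
  ext a b
  fin_cases a <;> fin_cases b <;>
    simp [star, Fin.sum_univ_four, epsilon_eq, eta] <;> norm_num <;> linarith

theorem star_antisymm {M : Fin 4 → Fin 4 → ℝ} (hM : ∀ d e, M d e = -M e d) (a b : Fin 4) :
    star M a b = -star M b a := by
  rw [star_eq hM]
  fin_cases a <;> fin_cases b <;> simp

/-- The Hodge dual of a coclosed two-form is closed; here `G d` is the derivative along `d`. -/
theorem star_cyclic {G : Fin 4 → Fin 4 → Fin 4 → ℝ} (hG : ∀ p d e, G p d e = -G p e d)
    (hdiv : ∀ m, ∑ d, eta d d * G d d m = 0) (a b c : Fin 4) :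
    star (G a) b c + star (G b) c a + star (G c) a b = 0 := by
  simp only [star_eq (hG _)]
  have h0 := hdiv 0
  have h1 := hdiv 1
  have h2 := hdiv 2
  have h3 := hdiv 3
  have hd (p d : Fin 4) : G p d d = 0 := by linarith [hG p d d]
  have e01 (p) := hG p 1 0
  have e02 (p) := hG p 2 0
  have e03 (p) := hG p 3 0
  have e12 (p) := hG p 2 1
  have e13 (p) := hG p 1 3
  have e23 (p) := hG p 3 2
  simp [Fin.sum_univ_four, eta, hd, e01, e02, e03, e12, e13, e23] at h0 h1 h2 h3
  -- With a repeated index the terms cancel; for distinct indices the sum is, up to sign, the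
  -- divergence at the remaining index.
  fin_cases a <;> fin_cases b <;> fin_cases c <;> simp <;> linarith

/-- The Hodge dual of a closed two-form is coclosed; here `G d` is the derivative along `d`. -/
theorem star_div {G : Fin 4 → Fin 4 → Fin 4 → ℝ} (hG : ∀ p d e, G p d e = -G p e d)
    (hcyc : ∀ a b c, G a b c + G b c a + G c a b = 0) (b : Fin 4) :
    ∑ a, eta a a * star (G a) a b = 0 := by
  simp only [star_eq (hG _)]
  have h0 := hcyc 1 2 3
  have h1 := hcyc 0 2 3
  have h2 := hcyc 0 1 3
  have h3 := hcyc 0 1 2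
  have e02 (p) := hG p 2 0
  have e13 (p) := hG p 1 3
  simp only [e02, e13] at h0 h1 h2 h3
  -- Component `b` is, up to sign, the cyclic identity for the three other indices.
  fin_cases b <;> simp [Fin.sum_univ_four, eta] <;>
    linarith [hG 2 0 3, hG 1 0 3, hG 0 2 3]

/-! ### Calculus of partial derivatives on an open set -/

section Calculus

variable {Ω : TopologicalSpace.Opens Spacetime} {f g : Spacetime → ℝ} {x : Spacetime}

theorem differentiableAt_of_contDiffOn (hf : ContDiffOn ℝ ∞ f Ω) (hx : x ∈ Ω) :
    DifferentiableAt ℝ f x :=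
  (hf.contDiffAt (Ω.isOpen.mem_nhds hx)).differentiableAt (by simp)

theorem contDiffOn_pd (hf : ContDiffOn ℝ ∞ f Ω) (a : Fin 4) : ContDiffOn ℝ ∞ (pd a f) Ω :=
  (hf.fderiv_of_isOpen Ω.isOpen (by simp)).clm_apply contDiffOn_const

theorem pd_congr (h : ∀ y ∈ Ω, f y = g y) (hx : x ∈ Ω) (a : Fin 4) : pd a f x = pd a g x := by
  have : f =ᶠ[nhds x] g := Filter.eventuallyEq_of_mem (Ω.isOpen.mem_nhds hx) h
  rw [pd, this.fderiv_eq, pd]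

theorem pd_add (hf : DifferentiableAt ℝ f x) (hg : DifferentiableAt ℝ g x) (a : Fin 4) :
    pd a (fun y => f y + g y) x = pd a f x + pd a g x := by
  simp [pd, fderiv_fun_add hf hg]

theorem pd_sub (hf : DifferentiableAt ℝ f x) (hg : DifferentiableAt ℝ g x) (a : Fin 4) :
    pd a (fun y => f y - g y) x = pd a f x - pd a g x := by
  simp [pd, fderiv_fun_sub hf hg]

theorem pd_zero (a : Fin 4) : pd a (fun _ => 0) x = 0 := by
  simp [pd]

theorem pd_sum {w : Fin 4 → ℝ} {F : Fin 4 → Spacetime → ℝ}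
    (hF : ∀ c, DifferentiableAt ℝ (F c) x) (a : Fin 4) :
    pd a (fun y => ∑ c, w c * F c y) x = ∑ c, w c * pd a (F c) x := by
  rw [pd, fderiv_fun_sum fun c _ => (hF c).const_mul (w c)]
  simp [pd, fderiv_const_mul (hF _)]

theorem pd_comm (hf : ContDiffOn ℝ ∞ f Ω) (hx : x ∈ Ω) (a b : Fin 4) :
    pd a (pd b f) x = pd b (pd a f) x := by
  have hc := hf.contDiffAt (Ω.isOpen.mem_nhds hx)
  have hd : DifferentiableAt ℝ (fderiv ℝ f) x :=
    (hc.fderiv_right (m := ∞) (by simp)).differentiableAt (by simp)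
  have key (a b : Fin 4) :
      pd a (pd b f) x = fderiv ℝ (fderiv ℝ f) x (Pi.single a 1) (Pi.single b 1) := by
    have := fderiv_clm_apply hd (differentiableAt_const (Pi.single b (1 : ℝ) : Spacetime))
    change fderiv ℝ (fun y => fderiv ℝ f y (Pi.single b 1)) x _ = _
    rw [this]
    simp
  rw [key, key]
  exact hc.isSymmSndFDerivAt (by simpa using ENat.LEInfty.out) _ _

theorem pd_star {M : Fin 4 → Fin 4 → Spacetime → ℝ}
    (hM : ∀ d e, DifferentiableAt ℝ (M d e) x) (p a b : Fin 4) :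
    pd p (fun y => star (fun d e => M d e y) a b) x = star (fun d e => pd p (M d e) x) a b := by
  have h1 (d : Fin 4) : DifferentiableAt ℝ
      (fun y => ∑ e, (1 / 2 * eta a a * eta b b * epsilon a b d e) * M d e y) x :=
    DifferentiableAt.fun_sum fun e _ => (hM d e).const_mul _
  have h2 := pd_sum (w := fun _ => 1) h1 p
  simp only [one_mul] at h2
  simp only [star]
  rw [h2]
  exact Finset.sum_congr rfl fun d _ => pd_sum (hM d) p

end Calculus

end

noncomputable section

/-! ### The traceless harmonic gauge -/

theorem eta_ne {a b : Fin 4} (h : a ≠ b) : eta a b = 0 := by simp [eta, h]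

theorem eta_mul_self (a : Fin 4) : eta a a * eta a a = 1 := by
  simp only [eta]; split_ifs <;> norm_num

theorem sum_eta (X : Fin 4 → Fin 4 → ℝ) : ∑ a, ∑ b, eta a b * X a b = ∑ a, eta a a * X a a :=
  Finset.sum_congr rfl fun a _ => Finset.sum_eq_single a
    (fun b _ hb => by rw [eta_ne hb.symm, zero_mul]) (by simp)

theorem trace_eq_sum (h : Tensor2) (x : Spacetime) : trace h x = ∑ a, eta a a * h x a a :=
  sum_eta _

theorem divergence_eq_sum (h : Tensor2) (x : Spacetime) (a : Fin 4) :
    divergence h x a = ∑ d, eta d d * pd d (fun y => h y d a) x :=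
  sum_eta _

variable {Ω : TopologicalSpace.Opens Spacetime} {h : Tensor2} {x : Spacetime}

theorem fierz_of_tracelessHarmonic (hg : IsTracelessHarmonic h Ω) (hx : x ∈ Ω) (a b c : Fin 4) :
    fierz h x a b c = 1 / 2 * (pd a (fun y => h y b c) x - pd b (fun y => h y a c) x) := by
  have ht (a : Fin 4) : pd a (trace h) x = 0 :=
    (pd_congr hg.trace_eq hx a).trans (pd_zero a)
  rw [fierz, hg.divergence_eq x hx, hg.divergence_eq x hx, ht, ht]
  ring

/-- After commuting partials, three of the four contracted terms are derivatives of the divergence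
or of the trace; only `□h` survives. -/
theorem ricci_of_tracelessHarmonic (hsm : ∀ a b, ContDiffOn ℝ ∞ (fun x => h x a b) Ω)
    (hsymm : ∀ x ∈ Ω, ∀ a b, h x a b = h x b a) (hg : IsTracelessHarmonic h Ω) (hx : x ∈ Ω)
    (a b : Fin 4) :
    ricci h x a b = -(1 / 2) * ∑ c, eta c c * pd c (pd c fun y => h y a b) x := by
  have hd2 (p q m n : Fin 4) : DifferentiableAt ℝ (pd p fun y => h y m n) x :=
    differentiableAt_of_contDiffOn (contDiffOn_pd (hsm m n) p) hx
  have hdiv (p a : Fin 4) : ∑ c, eta c c * pd p (pd c fun y => h y c a) x = 0 := by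
    rw [← pd_sum fun c => hd2 c c c a, pd_congr (Ω := Ω) (g := fun _ => 0) _ hx, pd_zero]
    intro y hy
    rw [← divergence_eq_sum, hg.divergence_eq y hy]
  have htr (p q : Fin 4) : ∑ c, eta c c * pd p (pd q fun y => h y c c) x = 0 := by
    rw [← pd_sum fun c => hd2 q q c c, pd_congr (Ω := Ω) (g := fun _ => 0) _ hx, pd_zero]
    intro y hy
    rw [← pd_sum fun c => differentiableAt_of_contDiffOn (hsm c c) hy,
      pd_congr (Ω := Ω) (g := fun _ => 0) _ hy, pd_zero]
    intro z hz
    rw [← trace_eq_sum, hg.trace_eq z hz]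
  have hsw (p q m n : Fin 4) : pd p (pd q fun y => h y m n) x = pd p (pd q fun y => h y n m) x :=
    pd_congr (fun y hy => pd_congr (fun z hz => hsymm z hz m n) hy q) hx p
  have h1 : ∀ c, eta c c * riemann h x a c b c = 1 / 2 * (eta c c * pd b (pd c fun y => h y c a) x)
      + 1 / 2 * (eta c c * pd a (pd c fun y => h y c b) x)
      - 1 / 2 * (eta c c * pd a (pd b fun y => h y c c) x)
      - 1 / 2 * (eta c c * pd c (pd c fun y => h y a b) x) := by
    intro c
    rw [riemann, pd_comm (hsm a c) hx c b, hsw b c a c]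
    ring
  rw [ricci, sum_eta (fun c d => riemann h x a c b d)]
  simp only [h1, Finset.sum_add_distrib, Finset.sum_sub_distrib, ← Finset.mul_sum, hdiv, htr]
  ring

/-- In the traceless harmonic gauge the linearized Einstein equations imply the wave equation. -/
theorem IsVacuumSolution.wave_eq (hs : IsVacuumSolution h Ω) (hg : IsTracelessHarmonic h Ω)
    (hx : x ∈ Ω) (a b : Fin 4) : ∑ c, eta c c * pd c (pd c fun y => h y a b) x = 0 := by
  have hE := hs.einstein_eq x hx
  have htr : trace (ricci h) x = 0 := by
    -- In dimension four the trace of the Einstein tensor is `R - 2R = -R`.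
    have h1 : ∑ a, eta a a * einstein h x a a = 0 := by simp [hE]
    have h2 : ∀ a, eta a a * einstein h x a a =
        eta a a * ricci h x a a - 1 / 2 * trace (ricci h) x := by
      intro a
      rw [einstein]
      linear_combination (-1 / 2 * trace (ricci h) x) * eta_mul_self a
    simp only [h2, Finset.sum_sub_distrib, ← trace_eq_sum] at h1
    simp at h1
    linarith
  have h3 := hE a b
  rw [einstein, htr, ricci_of_tracelessHarmonic hs.smooth hs.symm hg hx] at h3
  linarith

/-- In the traceless harmonic gauge the wave equation implies the linearized Einstein equations. -/
theorem IsVacuumSolution.of_wave_eq (hsm : ∀ a b, ContDiffOn ℝ ∞ (fun x => h x a b) Ω)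
    (hsymm : ∀ x ∈ Ω, ∀ a b, h x a b = h x b a) (hg : IsTracelessHarmonic h Ω)
    (hw : ∀ x ∈ Ω, ∀ a b, ∑ c, eta c c * pd c (pd c fun y => h y a b) x = 0) :
    IsVacuumSolution h Ω := by
  refine ⟨hsm, hsymm, fun x hx a b => ?_⟩
  have hr (a b : Fin 4) : ricci h x a b = 0 := by
    rw [ricci_of_tracelessHarmonic hsm hsymm hg hx, hw x hx, mul_zero]
  simp [einstein, trace, hr]

/-- A symmetric traceless tensor field whose curl is twice the Hodge dual of a tensor `F` with
suitable algebraic and differential properties is a solution in the traceless harmonic gauge. -/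
theorem tracelessHarmonic_of_curl (hsm : ∀ a b, ContDiffOn ℝ ∞ (fun x => h x a b) Ω)
    (hsymm : ∀ x ∈ Ω, ∀ a b, h x a b = h x b a) (htr : ∀ x ∈ Ω, trace h x = 0) {S : Tensor3}
    (hS : ∀ a b c, ContDiffOn ℝ ∞ (fun x => S x a b c) Ω)
    (hcurl : ∀ x ∈ Ω, ∀ a b c,
      pd a (fun y => h y b c) x - pd b (fun y => h y a c) x = 2 * S x a b c)
    (hStr : ∀ x ∈ Ω, ∀ a, ∑ b, eta b b * S x a b b = 0)
    (hSdiv : ∀ x ∈ Ω, ∀ b c, ∑ a, eta a a * pd a (fun y => S y a b c) x = 0) :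
    IsTracelessHarmonic h Ω ∧ IsVacuumSolution h Ω := by
  have hd (x) (hx : x ∈ Ω) (m n : Fin 4) : DifferentiableAt ℝ (fun y => h y m n) x :=
    differentiableAt_of_contDiffOn (hsm m n) hx
  have hdS (x) (hx : x ∈ Ω) (a m n : Fin 4) : DifferentiableAt ℝ (fun y => S y a m n) x :=
    differentiableAt_of_contDiffOn (hS a m n) hx
  have hdd (x) (hx : x ∈ Ω) (a m n : Fin 4) : DifferentiableAt ℝ (pd a fun y => h y m n) x :=
    differentiableAt_of_contDiffOn (contDiffOn_pd (hsm m n) a) hx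
  have hg : IsTracelessHarmonic h Ω := by
    refine ⟨fun x hx a => ?_, htr⟩
    have h1 : ∑ b, eta b b * pd a (fun y => h y b b) x = 0 := by
      rw [← pd_sum fun b => hd x hx b b, pd_congr (Ω := Ω) (g := fun _ => 0) _ hx, pd_zero]
      intro y hy
      rw [← trace_eq_sum, htr y hy]
    -- Contracting the curl equation in its last two indices expresses the divergence through the
    -- gradient of the trace and the trace of `S`.
    have h2 (b : Fin 4) : eta b b * pd b (fun y => h y b a) x =
        eta b b * pd a (fun y => h y b b) x - 2 * (eta b b * S x a b b) := by
      have := pd_congr (fun y hy => hsymm y hy b a) hx b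
      linear_combination (eta b b) * this - eta b b * hcurl x hx a b b
    rw [divergence_eq_sum]
    simp only [h2, Finset.sum_sub_distrib, ← Finset.mul_sum, h1, hStr x hx]
    ring
  refine ⟨hg, .of_wave_eq hsm hsymm hg fun x hx a b => ?_⟩
  -- The divergence of the curl equation reads `□h_{ab} = ∂_a ∂^c h_{cb} + 2 ∂^c S_{cab}`, and both
  -- terms on the right vanish.
  have h3 (c : Fin 4) : pd c (pd c fun y => h y a b) x =
      pd a (pd c fun y => h y c b) x + 2 * pd c (fun y => S y c a b) x := by
    rw [← pd_comm (hsm c b) hx c a, ← pd_const_mul 2 (hdS x hx c a b),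
      ← pd_add (hdd x hx a c b) ((hdS x hx c a b).const_mul 2)]
    exact pd_congr (fun y hy => by linarith [hcurl y hy c a b]) hx c
  have h4 : ∑ c, eta c c * pd a (pd c fun y => h y c b) x = 0 := by
    rw [← pd_sum fun c => hdd x hx c c b, pd_congr (Ω := Ω) (g := fun _ => 0) _ hx, pd_zero]
    intro y hy
    rw [← divergence_eq_sum, hg.divergence_eq y hy]
  have h5 (c : Fin 4) : eta c c * pd c (pd c fun y => h y a b) x =
      eta c c * pd a (pd c fun y => h y c b) x + 2 * (eta c c * pd c (fun y => S y c a b) x) := by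
    rw [h3]; ring
  simp only [h5, Finset.sum_add_distrib, ← Finset.mul_sum, h4, hSdiv x hx]
  ring

/-! ### Restriction and cut-off -/

theorem IsVacuumSolution.mono {U : TopologicalSpace.Opens Spacetime} (hs : IsVacuumSolution h Ω)
    (hU : U ≤ Ω) : IsVacuumSolution h U :=
  ⟨fun a b => (hs.smooth a b).mono hU, fun x hx => hs.symm x (hU hx),
    fun x hx => hs.einstein_eq x (hU hx)⟩

/-- A function that is smooth on `Ω` agrees near a compact subset with a smooth function of compact
support. -/
theorem exists_contDiff_hasCompactSupport_eqOn {f : Spacetime → ℝ} (hf : ContDiffOn ℝ ∞ f Ω)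
    {K : Set Spacetime} (hK : IsCompact K) (hKΩ : K ⊆ Ω) :
    ∃ g : Spacetime → ℝ, ContDiff ℝ ∞ g ∧ HasCompactSupport g ∧ ∀ x ∈ K, g x = f x := by
  obtain ⟨L, hL, hKL, hLΩ⟩ := exists_compact_between hK Ω.isOpen hKΩ
  obtain ⟨ρ, h1, h0, -⟩ := exists_contMDiffMap_one_nhds_of_subset_interior (n := ⊤)
    (modelWithCornersSelf ℝ Spacetime) hK.isClosed hKL
  have hρ : ContDiff ℝ ∞ ρ := ρ.contMDiff.contDiff
  refine ⟨fun x => ρ x * f x, contDiff_iff_contDiffAt.2 fun x => ?_,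
    HasCompactSupport.intro hL fun x hx => by rw [h0 x hx, zero_mul], fun x hx => ?_⟩
  · by_cases hx : x ∈ Ω
    · exact hρ.contDiffAt.mul (hf.contDiffAt (Ω.isOpen.mem_nhds hx))
    -- Off `Ω` nothing is known about `f`, but the cut-off vanishes on the complement of `L`, an
    -- open neighbourhood of `x`.
    · have hx' : x ∉ L := fun h => hx (hLΩ h)
      refine (contDiffAt_const (c := (0 : ℝ))).congr_of_eventuallyEq ?_
      filter_upwards [hL.isClosed.isOpen_compl.mem_nhds hx'] with y hy
      rw [h0 y hy, zero_mul]
  · simp [h1.self_of_nhdsSet x hx]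

end

noncomputable section

/-! ### The dual of the Fierz tensor -/

/-- The Fierz tensor of a field in the traceless harmonic gauge. -/
def curl (h : Tensor2) : Tensor3 := fun x a b c =>
  1 / 2 * (pd a (fun y => h y b c) x - pd b (fun y => h y a c) x)

/-- The Hodge dual of `curl h` in the first two indices. -/
def dualCurl (h : Tensor2) : Tensor3 := fun x a b c => star (fun d e => curl h x d e c) a b

theorem curl_antisymm (h : Tensor2) (x : Spacetime) (c d e : Fin 4) :
    curl h x d e c = -curl h x e d c := by
  rw [curl, curl]; ring

section DualCurl

variable {Ω : TopologicalSpace.Opens Spacetime} {h : Tensor2} {x : Spacetime}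

theorem hodge_fierz (hg : IsTracelessHarmonic h Ω) (hx : x ∈ Ω) (a b c : Fin 4) :
    hodge (fierz h) x a b c = dualCurl h x a b c := by
  simp only [hodge_eq_star, dualCurl, curl, fierz_of_tracelessHarmonic hg hx]

theorem contDiffOn_curl (hsm : ∀ a b, ContDiffOn ℝ ∞ (fun x => h x a b) Ω) (a b c : Fin 4) :
    ContDiffOn ℝ ∞ (fun x => curl h x a b c) Ω :=
  contDiffOn_const.mul ((contDiffOn_pd (hsm b c) a).sub (contDiffOn_pd (hsm a c) b))

theorem contDiffOn_dualCurl (hsm : ∀ a b, ContDiffOn ℝ ∞ (fun x => h x a b) Ω) (a b c : Fin 4) :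
    ContDiffOn ℝ ∞ (fun x => dualCurl h x a b c) Ω := by
  simp only [dualCurl, star]
  exact ContDiffOn.sum fun d _ => ContDiffOn.sum fun e _ =>
    contDiffOn_const.mul (contDiffOn_curl hsm d e c)

theorem dualCurl_antisymm (h : Tensor2) (x : Spacetime) (a b c : Fin 4) :
    dualCurl h x a b c = -dualCurl h x b a c :=
  star_antisymm (curl_antisymm h x c) a b

theorem pd_curl (hsm : ∀ a b, ContDiffOn ℝ ∞ (fun x => h x a b) Ω) (hx : x ∈ Ω)
    (p a b c : Fin 4) : pd p (fun y => curl h y a b c) x =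
      1 / 2 * (pd p (pd a fun y => h y b c) x - pd p (pd b fun y => h y a c) x) := by
  have hdd (a m n : Fin 4) : DifferentiableAt ℝ (pd a fun y => h y m n) x :=
    differentiableAt_of_contDiffOn (contDiffOn_pd (hsm m n) a) hx
  simp only [curl]
  rw [pd_const_mul _ ((hdd a b c).fun_sub (hdd b a c)), pd_sub (hdd a b c) (hdd b a c)]

theorem pd_curl_antisymm (hsm : ∀ a b, ContDiffOn ℝ ∞ (fun x => h x a b) Ω) (hx : x ∈ Ω)
    (c p d e : Fin 4) :
    pd p (fun y => curl h y d e c) x = -pd p (fun y => curl h y e d c) x := by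
  rw [pd_curl hsm hx, pd_curl hsm hx]; ring

theorem pd_dualCurl (hsm : ∀ a b, ContDiffOn ℝ ∞ (fun x => h x a b) Ω) (hx : x ∈ Ω)
    (p a b c : Fin 4) : pd p (fun y => dualCurl h y a b c) x =
      star (fun d e => pd p (fun y => curl h y d e c) x) a b :=
  pd_star (fun d e => differentiableAt_of_contDiffOn (contDiffOn_curl hsm d e c) hx) p a b

/-- The dual of a coclosed form is closed, and the divergence of the curl is `½ (□h_{mp} - ∂_m ∂^d
h_{dp}) = 0`. -/
theorem dualCurl_closed (hs : IsVacuumSolution h Ω) (hg : IsTracelessHarmonic h Ω) (hx : x ∈ Ω)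
    (a b c p : Fin 4) : pd a (fun y => dualCurl h y b c p) x
      + pd b (fun y => dualCurl h y c a p) x + pd c (fun y => dualCurl h y a b p) x = 0 := by
  have hsm := hs.smooth
  simp only [pd_dualCurl hsm hx]
  refine star_cyclic (G := fun a d e => pd a (fun y => curl h y d e p) x)
    (pd_curl_antisymm hsm hx p) (fun m => ?_) a b c
  have hdiv : ∑ d, eta d d * pd m (pd d fun y => h y d p) x = 0 := by
    rw [← pd_sum fun d => differentiableAt_of_contDiffOn (contDiffOn_pd (hsm d p) d) hx,
      pd_congr (Ω := Ω) (g := fun _ => 0) _ hx, pd_zero]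
    intro y hy
    rw [← divergence_eq_sum, hg.divergence_eq y hy]
  have h1 (d : Fin 4) : eta d d * pd d (fun y => curl h y d m p) x =
      1 / 2 * (eta d d * pd d (pd d fun y => h y m p) x)
        - 1 / 2 * (eta d d * pd m (pd d fun y => h y d p) x) := by
    rw [pd_curl hsm hx, pd_comm (hsm d p) hx d m]; ring
  simp only [h1, Finset.sum_sub_distrib, ← Finset.mul_sum, hdiv, hs.wave_eq hg hx]
  ring

/-- The same algebra with the third index in the role of the derivative: the required trace of the
curl is half the divergence of `h` minus half the gradient of its trace. This will make the
antisymmetric part of the potential closed. -/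
theorem dualCurl_cyclic (hs : IsVacuumSolution h Ω) (hg : IsTracelessHarmonic h Ω) (hx : x ∈ Ω)
    (a b c : Fin 4) : dualCurl h x b c a + dualCurl h x c a b + dualCurl h x a b c = 0 := by
  refine star_cyclic (G := fun a d e => curl h x d e a)
    (curl_antisymm h x) (fun m => ?_) a b c
  have htr : ∑ d, eta d d * pd m (fun y => h y d d) x = 0 := by
    rw [← pd_sum fun d => differentiableAt_of_contDiffOn (hs.smooth d d) hx,
      pd_congr (Ω := Ω) (g := fun _ => 0) _ hx, pd_zero]
    intro y hy
    rw [← trace_eq_sum, hg.trace_eq y hy]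
  have hdiv := hg.divergence_eq x hx m
  rw [divergence_eq_sum] at hdiv
  have h1 (d : Fin 4) : eta d d * curl h x d m d =
      1 / 2 * (eta d d * pd d (fun y => h y d m) x)
        - 1 / 2 * (eta d d * pd m (fun y => h y d d) x) := by
    rw [curl, pd_congr (fun y hy => hs.symm y hy m d) hx d]; ring
  simp only [h1, Finset.sum_sub_distrib, ← Finset.mul_sum, hdiv, htr]
  ring

/-- By symmetry of `h` the curl satisfies the cyclic identity, whose Hodge dual is the vanishing of
the trace. -/
theorem dualCurl_trace (hs : IsVacuumSolution h Ω) (hx : x ∈ Ω) (a : Fin 4) :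
    ∑ b, eta b b * dualCurl h x a b b = 0 := by
  have h1 := star_div (G := fun a d e => curl h x d e a) (curl_antisymm h x) (fun a b c => by
    have e (p m n : Fin 4) := pd_congr (fun y hy => hs.symm y hy m n) hx p
    simp only [curl]
    rw [e b c a, e c b a, e a c b]
    ring) a
  have h2 (b : Fin 4) : eta b b * dualCurl h x a b b =
      -(eta b b * star (fun d e => curl h x d e b) b a) := by
    rw [dualCurl_antisymm, dualCurl]; ring
  simp only [h2, Finset.sum_neg_distrib, h1, neg_zero]

/-- For fixed `c` the curl is an exact two-form, hence closed, so its dual is coclosed. -/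
theorem dualCurl_div (hsm : ∀ a b, ContDiffOn ℝ ∞ (fun x => h x a b) Ω) (hx : x ∈ Ω)
    (b c : Fin 4) : ∑ a, eta a a * pd a (fun y => dualCurl h y a b c) x = 0 := by
  simp only [pd_dualCurl hsm hx]
  refine star_div (G := fun a d e => pd a (fun y => curl h y d e c) x)
    (pd_curl_antisymm hsm hx c) (fun p q r => ?_) b
  simp only [pd_curl hsm hx]
  rw [pd_comm (hsm r c) hx p q, pd_comm (hsm q c) hx p r, pd_comm (hsm p c) hx q r]
  ring

/-- If `H²(Ω) = 0`, the Hodge dual of the Fierz tensor has a symmetric potential. -/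
theorem exists_symmetric_potential (hΩ : Subsingleton (DeRhamCohomology 2 Ω))
    (hs : IsVacuumSolution h Ω) (hg : IsTracelessHarmonic h Ω) :
    ∃ k : Tensor2, (∀ a b, ContDiffOn ℝ ∞ (fun x => k x a b) Ω) ∧
      (∀ x ∈ Ω, ∀ a b, k x a b = k x b a) ∧ ∀ x ∈ Ω, ∀ a b c,
        pd a (fun y => k y b c) x - pd b (fun y => k y a c) x = 2 * dualCurl h x a b c := by
  have hD := contDiffOn_dualCurl hs.smooth
  have hpot (c : Fin 4) := exists_potential hΩ (A := fun x a b => 2 * dualCurl h x a b c)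
    (fun a b => contDiffOn_const.mul (hD a b c))
    (fun x _ a b => by linarith [dualCurl_antisymm h x a b c])
    (fun x hx p q r => by
      have hd (m n : Fin 4) := differentiableAt_of_contDiffOn (hD m n c) hx
      rw [pd_const_mul 2 (hd _ _), pd_const_mul 2 (hd _ _), pd_const_mul 2 (hd _ _)]
      linarith [dualCurl_closed hs hg hx p q r c])
  choose k hk hkd using hpot
  have hdk (x) (hx : x ∈ Ω) (b c : Fin 4) : DifferentiableAt ℝ (fun y => k c y b) x :=
    differentiableAt_of_contDiffOn (hk c b) hx
  -- Grouped by the label of the one-form `k`, the cyclic derivative of the antisymmetric part is a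
  -- cyclic sum of curls, zero by `dualCurl_cyclic`.
  obtain ⟨ξ, hξ, hξd⟩ := exists_potential hΩ (A := fun x b c => k c x b - k b x c)
    (fun b c => (hk c b).sub (hk b c)) (fun x _ b c => by ring)
    (fun x hx p q r => by
      rw [pd_sub (hdk x hx _ _) (hdk x hx _ _), pd_sub (hdk x hx _ _) (hdk x hx _ _),
        pd_sub (hdk x hx _ _) (hdk x hx _ _)]
      linarith [dualCurl_cyclic hs hg hx p q r, hkd p x hx q r, hkd q x hx r p, hkd r x hx p q])
  -- For each `c` the correction is a gradient in the index `b`, so the curl is unchanged.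
  refine ⟨fun x b c => k c x b - pd b (fun y => ξ y c) x,
    fun b c => (hk c b).sub (contDiffOn_pd (hξ c) b), fun x hx b c => ?_, fun x hx a b c => ?_⟩
  · linarith [hξd x hx b c]
  · have hdξ (a b : Fin 4) : DifferentiableAt ℝ (pd a fun y => ξ y b) x :=
      differentiableAt_of_contDiffOn (contDiffOn_pd (hξ b) a) hx
    rw [pd_sub (hdk x hx b c) (hdξ b c), pd_sub (hdk x hx a c) (hdξ a c), pd_comm (hξ c) hx a b]
    linarith [hkd c x hx a b]

/-- On a relatively compact part of `Ω` a symmetric tensor field can be made traceless by adding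
the Hessian of a function. -/
theorem exists_traceless_add_hessian {U : TopologicalSpace.Opens Spacetime}
    (hU : Bornology.IsBounded (U : Set Spacetime)) (hUΩ : closure (U : Set Spacetime) ⊆ Ω)
    {k : Tensor2} (hk : ∀ a b, ContDiffOn ℝ ∞ (fun x => k x a b) Ω) :
    ∃ χ : Spacetime → ℝ, ContDiff ℝ ∞ χ ∧
      ∀ x ∈ U, trace (fun y a b => k y a b + pd a (pd b χ) y) x = 0 := by
  have htr : ContDiffOn ℝ ∞ (trace k) Ω :=
    ContDiffOn.sum fun a _ => ContDiffOn.sum fun b _ => contDiffOn_const.mul (hk a b)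
  obtain ⟨g, hg, hgc, hgk⟩ :=
    exists_contDiff_hasCompactSupport_eqOn htr hU.isCompact_closure hUΩ
  -- The Hessian has trace `□χ`, so the source is minus the cut-off trace, which is exact on `U`.
  obtain ⟨χ, hχ, hw⟩ := exists_wave_solution hg.neg hgc.neg
  refine ⟨χ, hχ, fun x hx => ?_⟩
  have h1 := hw x
  have h2 := hgk x (subset_closure hx)
  rw [trace_eq_sum] at h2 ⊢
  simp [Fin.sum_univ_four, eta] at h1 h2 ⊢
  linarith

/-- If `H²(Ω) = 0`, a source-free solution on `Ω` in the traceless harmonic gauge has a dual in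
that gauge on every open set that is relatively compact in `Ω`. -/
theorem exists_isDual {U : TopologicalSpace.Opens Spacetime}
    (hΩ : Subsingleton (DeRhamCohomology 2 Ω)) (hU : Bornology.IsBounded (U : Set Spacetime))
    (hUΩ : closure (U : Set Spacetime) ⊆ Ω) (hsol : IsVacuumSolution h Ω)
    (hgauge : IsTracelessHarmonic h Ω) :
    ∃ h' : Tensor2, IsDual h' h U ∧ IsTracelessHarmonic h' U := by
  have hle : U ≤ Ω := fun x hx => hUΩ (subset_closure hx)
  obtain ⟨k, hk, hksymm, hkcurl⟩ := exists_symmetric_potential hΩ hsol hgauge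
  obtain ⟨χ, hχ, htr⟩ := exists_traceless_add_hessian hU hUΩ hk
  have hχ1 (b : Fin 4) : ContDiffOn ℝ ∞ (pd b χ) U := contDiffOn_pd hχ.contDiffOn b
  have hχ2 (a b : Fin 4) : ContDiffOn ℝ ∞ (pd a (pd b χ)) U := contDiffOn_pd (hχ1 b) a
  -- The Hessian drops out of the curl because third partial derivatives commute.
  have hcurl : ∀ x ∈ U, ∀ a b c, pd a (fun y => k y b c + pd b (pd c χ) y) x
      - pd b (fun y => k y a c + pd a (pd c χ) y) x = 2 * dualCurl h x a b c := by
    intro x hx a b c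
    have hdk (a b : Fin 4) := differentiableAt_of_contDiffOn (hk a b) (hle hx)
    have hdχ (a b : Fin 4) := differentiableAt_of_contDiffOn (hχ2 a b) hx
    rw [pd_add (hdk b c) (hdχ b c), pd_add (hdk a c) (hdχ a c), pd_comm (hχ1 c) hx a b]
    linarith [hkcurl x (hle hx) a b c]
  obtain ⟨hg', hs'⟩ := tracelessHarmonic_of_curl (Ω := U)
    (h := fun y a b => k y a b + pd a (pd b χ) y) (S := dualCurl h)
    (fun a b => ((hk a b).mono hle).add (hχ2 a b))
    (fun x hx a b => by rw [hksymm x (hle hx) a b, pd_comm (Ω := U) hχ.contDiffOn hx a b])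
    htr (fun a b c => (contDiffOn_dualCurl hsol.smooth a b c).mono hle) hcurl
    (fun x hx => dualCurl_trace hsol (hle hx))
    (fun x hx => dualCurl_div hsol.smooth (hle hx))
  refine ⟨_, ⟨hsol.mono hle, hs', fun x hx a b c => ?_⟩, hg'⟩
  rw [hodge_fierz hgauge (hle hx), fierz_of_tracelessHarmonic hg' hx, hcurl x hx]
  ring

end DualCurl

end

end LinGrav

theorem mainTheorem5 (Ω U : TopologicalSpace.Opens LinGrav.Spacetime)
    (hΩ : Subsingleton (LinGrav.DeRhamCohomology 2 Ω))
    (hU : Bornology.IsBounded (U : Set LinGrav.Spacetime))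
    (hUΩ : closure (U : Set LinGrav.Spacetime) ⊆ (Ω : Set LinGrav.Spacetime))
    (h : LinGrav.Tensor2)
    (hsol : LinGrav.IsVacuumSolution h Ω)
    (hgauge : LinGrav.IsTracelessHarmonic h Ω) :
    ∃ h' : LinGrav.Tensor2,
      LinGrav.IsDual h' h U ∧ LinGrav.IsTracelessHarmonic h' U :=
  LinGrav.exists_isDual hΩ hU hUΩ hsol hgauge
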